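/- A $d$-graph $G=(V,E)$ is a simple graph whose vertices are points of $\mathbb{R}^d$ and whose edges are line segments joining them, such that $G$ is invariant under the translations by the vectors of the canonical basis of $\mathbb{R}^d$, every vertex $v$ has finite degree $d_v$, and every bounded region of $\mathbb{R}^d$ contains finitely many vertices. Its maximal degree $d_G=\sup_{v\in V} d_v$ is then finite. For a finite $A\subset V$, $\sigma\in\{-1,+1\}^V$ and $\mathcal{J}\in\{-1,+1\}^E$, let $\sigma^{(A)}$ be $\sigma$ with the spins in $A$ reversed, and let $$\Delta_A\mathcal{H}_{\mathcal{J}}(\sigma)=2\sum_{e=\{x,y\}\in E:\ x\in A,\ y\notin A}J_e\,\sigma_x\sigma_y .$$ A temperature profile is a Borel function $T:[0,\infty)\to[0,\infty)$; the flip rate of $A$ at time $t$ is $$c_t^{(A)}(\sigma)=\frac{1}{1+e^{2\Delta_A\mathcal{H}_{\mathcal{J}}(\sigma)/T(t)}}\quad\text{if } T(t)>0,$$ and, if $T(t)=0$, it is the limit of this expression as the temperature tends to $0^+$ (that is $0$, $\tfrac12$, $1$ according to $\Delta_A\mathcal{H}_{\mathcal{J}}(\sigma)>0$, $=0$, $<0$).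 For $k\in\mathbb{N}$, $k\ge 1$, let $\mathcal{A}_k$ be the collection of nonempty connected sets $A\subset V$ with at most $k$ elements. Let $(\mathcal{P}_A)_{A\in\mathcal{A}_k}$ be independent Poisson processes of rate $1$ with arrival times $\tau_{A,1}<\tau_{A,2}<\cdots$, and let $U_{A,n}$ be i.i.d. uniform on $[0,1]$, independent of them. The $(k,\langle\mathcal{J}\rangle,\langle\sigma\rangle;T)$-model on $G$ is the left-continuous process $(\sigma(t))_{t\ge0}$ with values in $\{-1,+1\}^V$ and $\sigma(0)=\sigma$ that is driven by these variables: a spin can change only at an arrival of some $\mathcal{P}_A$ with $A$ containing its vertex, and at $t=\tau_{A,n}$ there is a flip at $A$, i.e. $\sigma(t^+)=\sigma(t)^{(A)}$, if $U_{A,n}<c_t^{(A)}(\sigma(t))$, while $\sigma(t^+)=\sigma(t)$ otherwise. The model is of type $\mathcal{I}$ if, almost surely, such a trajectory exists and, along any such trajectory, for every $x\in V$ there are infinitely many times of a flip at some $A\in\mathcal{A}_k$ with $x\in A$. **Statement.** Let $G$ be a $d$-graph and let $T$ be a temperature profile such that $\liminf_{t\to\infty}T(t)\ln t>4d_G$ (the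 lower limit may be $+\infty$). Then, for every $k\ge1$, every $\mathcal{J}\in\{-1,+1\}^E$ and every $\sigma\in\{-1,+1\}^V$, the $(k,\langle\mathcal{J}\rangle,\langle\sigma\rangle;T)$-model on $G$ is of type $\mathcal{I}$. -/

import Mathlib

open Filter Topology MeasureTheory ProbabilityTheory
open scoped NNReal

/-- A `d`-graph: a simple graph whose vertices are points of `ℝ^d` (an edge being the line segment
joining its two endpoints), which is invariant under the translations by the vectors of the
canonical basis, in which all degrees are finite, and which has finitely many vertices in every
bounded region. -/
structure DGraph (d : ℕ) where
  /-- the vertex set -/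
  V : Set (EuclideanSpace ℝ (Fin d))
  /-- the edges -/
  graph : SimpleGraph V
  vertex_shift : ∀ (i : Fin d) (x : EuclideanSpace ℝ (Fin d)),
    x + EuclideanSpace.single i (1 : ℝ) ∈ V ↔ x ∈ V
  adj_shift : ∀ (i : Fin d) (x y : V),
    graph.Adj ⟨x.1 + EuclideanSpace.single i (1 : ℝ), (vertex_shift i x).2 x.2⟩
      ⟨y.1 + EuclideanSpace.single i (1 : ℝ), (vertex_shift i y).2 y.2⟩ ↔ graph.Adj x y
  degree_finite : ∀ v : V, (graph.neighborSet v).Finite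
  locally_finite : ∀ S : Set (EuclideanSpace ℝ (Fin d)), Bornology.IsBounded S → (V ∩ S).Finite

namespace DGraph

variable {d : ℕ} (G : DGraph d)

/-- The degree `d_v` of a vertex. -/
noncomputable def degree (v : G.V) : ℕ := (G.graph.neighborSet v).ncard

/-- The maximal degree `d_G` (a genuine maximum, by `bddAbove_range_degree` below). -/
noncomputable def maxDegree : ℕ := sSup (Set.range G.degree)

/-- Configurations of spins `±1` on the vertices, with the product topology. -/
abbrev Config : Type := G.V → ℤˣ

/-- Interactions `±1` on the edges. -/
abbrev Interaction : Type := G.graph.edgeSet → ℤˣ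

/-- The boundary `∂A`. -/
def boundary (A : Finset G.V) : Set G.V := {v | v ∈ A ∧ ∃ u ∉ A, G.graph.Adj u v}

/-- The external boundary `∂^ext A`. -/
def extBoundary (A : Finset G.V) : Set G.V := {v | v ∉ A ∧ ∃ u ∈ A, G.graph.Adj u v}

/-- The edges `{x, y}` with `x ∈ ∂A` and `y ∈ ∂^ext A`. -/
def edgeBoundary (A : Finset G.V) : Set G.graph.edgeSet :=
  {e | ∃ x ∈ G.boundary A, ∃ y ∈ G.extBoundary A, (e : Sym2 G.V) = s(x, y)}

open Classical in
/-- The configuration `σ^(A)`, that is `σ` flipped on `A`. -/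
noncomputable def flip (A : Finset G.V) (σ : G.Config) : G.Config :=
  fun y => if y ∈ A then - σ y else σ y

/-- The increment of the Hamiltonian at `A`: twice the sum over the edges `e = {x, y}` with
`x ∈ ∂A`, `y ∈ ∂^ext A` of `J_e σ_x σ_y` (a finite sum, by `edgeBoundary_finite` below). -/
noncomputable def deltaH (J : G.Interaction) (A : Finset G.V) (σ : G.Config) : ℤ :=
  2 * ∑ᶠ e ∈ G.edgeBoundary A, ((J e * ((e : Sym2 G.V).map σ).mul : ℤˣ) : ℤ)

/-- The heat-bath rate at energy increment `D` and temperature `T`, extended to `T = 0` by its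
limit as `T → 0+`. -/
noncomputable def heatBath (D : ℤ) (T : ℝ≥0) : ℝ :=
  if T = 0 then (if 0 < D then 0 else if D = 0 then 1 / 2 else 1)
  else Real.exp (-(D : ℝ) / T) / (Real.exp ((D : ℝ) / T) + Real.exp (-(D : ℝ) / T))

/-- The flip rate `c_t^{J,T,(A)}(σ)`. -/
noncomputable def rate (J : G.Interaction) (T : ℝ≥0 → ℝ≥0) (A : Finset G.V) (t : ℝ≥0)
    (σ : G.Config) : ℝ :=
  heatBath (G.deltaH J A σ) (T t)

/-- `𝒜_k`: the (nonempty) connected sets of at most `k` vertices. -/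
def FlipSet (k : ℕ) : Type :=
  {A : Finset G.V // (G.graph.induce (A : Set G.V)).Connected ∧ A.card ≤ k}

/-- Sample points of the graphical representation: for every `A ∈ 𝒜_k` and `n`, the waiting time
before the `n`-th arrival at `A` (counted from `n = 0`) and the mark `U_{A,n} ∈ [0,1]`. -/
abbrev Sample (k : ℕ) : Type := G.FlipSet k × ℕ → ℝ × unitInterval

instance : IsProbabilityMeasure (expMeasure 1) := isProbabilityMeasure_expMeasure one_pos

/-- The law `P_k` of the graphical representation: all waiting times and marks are independent, the
waiting times exponential of rate `1` (so that the arrivals at the different `A` form independent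
Poisson processes of rate `1`), the marks uniform in `[0,1]`. -/
noncomputable def harrisMeasure (k : ℕ) : Measure (G.Sample k) :=
  Measure.infinitePi fun _ => (expMeasure 1).prod (volume : Measure unitInterval)

variable {k : ℕ}

/-- The arrival time `τ_{A,n}`. -/
noncomputable def arrival (ω : G.Sample k) (A : G.FlipSet k) (n : ℕ) : ℝ≥0 :=
  (∑ i ∈ Finset.range (n + 1), (ω (A, i)).1).toNNReal

/-- The set `𝒯_A` of arrivals at `A`. -/
def arrivals (ω : G.Sample k) (A : G.FlipSet k) : Set ℝ≥0 := Set.range (G.arrival ω A)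

/-- `σ` is a trajectory with initial configuration `σ₀` driven by the sample point `ω`: it is left
continuous; no spin jumps except at arrivals at sets that contain its vertex; at `t = τ_{A,n}` the
spins of `A` are flipped, `σ(t+) = σ^(A)(t)`, if `U_{A,n} < c_t(σ(t))`, and nothing changes
otherwise. (Almost surely, no two arrivals coincide.) -/
structure IsTrajectory (J : G.Interaction) (σ₀ : G.Config) (T : ℝ≥0 → ℝ≥0) (ω : G.Sample k)
    (σ : ℝ≥0 → G.Config) : Prop where
  init : σ 0 = σ₀
  left_cont : ∀ t, Tendsto σ (𝓝[<] t) (𝓝 (σ t))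
  no_arrival : ∀ (t : ℝ≥0) (v : G.V),
    (∀ A : G.FlipSet k, v ∈ A.1 → t ∉ G.arrivals ω A) →
      Tendsto (fun s => σ s v) (𝓝[>] t) (𝓝 (σ t v))
  flip : ∀ (A : G.FlipSet k) (n : ℕ),
    ((ω (A, n)).2 : ℝ) < G.rate J T A.1 (G.arrival ω A n) (σ (G.arrival ω A n)) →
      Tendsto σ (𝓝[>] (G.arrival ω A n)) (𝓝 (G.flip A.1 (σ (G.arrival ω A n))))
  no_flip : ∀ (A : G.FlipSet k) (n : ℕ),
    ¬ ((ω (A, n)).2 : ℝ) < G.rate J T A.1 (G.arrival ω A n) (σ (G.arrival ω A n)) →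
      Tendsto σ (𝓝[>] (G.arrival ω A n)) (𝓝 (σ (G.arrival ω A n)))

/-- The set `𝒩_x` of the times of all flips involving `x`: arrival times `t` at some `A ∋ x` with
`σ(t+) = σ^(A)(t)`. -/
def flipTimes (ω : G.Sample k) (σ : ℝ≥0 → G.Config) (x : G.V) : Set ℝ≥0 :=
  {t | ∃ A : G.FlipSet k, x ∈ A.1 ∧ t ∈ G.arrivals ω A ∧
    Tendsto σ (𝓝[>] t) (𝓝 (G.flip A.1 (σ t)))}

/-- The `(k, ⟨J⟩, ⟨σ₀⟩; T)`-model is of type `ℐ`: almost surely, the graphical representation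
drives a trajectory started from `σ₀`, and every site flips infinitely many times along it. -/
def IsTypeI (k : ℕ) (J : G.Interaction) (σ₀ : G.Config) (T : ℝ≥0 → ℝ≥0) : Prop :=
  ∀ᵐ ω ∂(G.harrisMeasure k),
    (∃ σ, G.IsTrajectory J σ₀ T ω σ) ∧
      ∀ σ, G.IsTrajectory J σ₀ T ω σ → ∀ x : G.V, (G.flipTimes ω σ x).Infinite

/-- The sum that defines `deltaH` is finite. -/
theorem edgeBoundary_finite (A : Finset G.V) : (G.edgeBoundary A).Finite := by
  have h : (⋃ x ∈ (A : Set G.V), (fun y => s(x, y)) '' G.graph.neighborSet x).Finite :=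
    A.finite_toSet.biUnion fun x _ => (G.degree_finite x).image _
  refine Set.Finite.of_finite_image (f := Subtype.val) (h.subset ?_)
    Subtype.val_injective.injOn
  rintro _ ⟨e, ⟨x, hx, y, hy, hxy⟩, rfl⟩
  have hadj : G.graph.Adj x y := by
    have := e.2
    rw [hxy] at this
    exact this
  exact Set.mem_biUnion (x := x) hx.1 ⟨y, hadj, hxy.symm⟩

/-- The degree is invariant under the translations by the canonical basis. -/
theorem degree_shift (i : Fin d) (x : G.V) :
    G.degree ⟨x.1 + EuclideanSpace.single i (1 : ℝ), (G.vertex_shift i x).2 x.2⟩ = G.degree x := by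
  unfold degree
  symm
  refine Set.ncard_congr
    (fun y _ => ⟨y.1 + EuclideanSpace.single i (1 : ℝ), (G.vertex_shift i y).2 y.2⟩) ?_ ?_ ?_
  · intro y hy
    exact (G.adj_shift i x y).2 hy
  · intro y z _ _ h
    exact Subtype.ext (add_right_cancel (Subtype.ext_iff.1 h))
  · intro z hz
    have hz' : (z : EuclideanSpace ℝ (Fin d)) - EuclideanSpace.single i 1 ∈ G.V := by
      rw [← G.vertex_shift i, sub_add_cancel]; exact z.2
    refine ⟨⟨_, hz'⟩, ?_, Subtype.ext (sub_add_cancel _ _)⟩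
    rw [SimpleGraph.mem_neighborSet, ← G.adj_shift i]
    have : (⟨(z : EuclideanSpace ℝ (Fin d)) - EuclideanSpace.single i 1
        + EuclideanSpace.single i 1, (G.vertex_shift i _).2 hz'⟩ : G.V) = z :=
      Subtype.ext (sub_add_cancel _ _)
    rw [this]; exact hz

/-- Translating by an integer vector does not change vertices and degrees. -/
theorem exists_shift (z : Fin d → ℤ) (s : Finset (Fin d)) (x : G.V) :
    ∃ y : G.V, (y : EuclideanSpace ℝ (Fin d)) =
      x + ∑ i ∈ s, (z i : ℝ) • EuclideanSpace.single i (1 : ℝ) ∧ G.degree y = G.degree x := by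
  classical
  induction s using Finset.induction_on with
  | empty => exact ⟨x, by simp, rfl⟩
  | insert i s hi ih =>
    obtain ⟨y, hy, hd⟩ := ih
    have key : ∀ m : ℤ, ∃ w : G.V, (w : EuclideanSpace ℝ (Fin d)) =
        y + (m : ℝ) • EuclideanSpace.single i (1 : ℝ) ∧ G.degree w = G.degree y := by
      intro m
      induction m using Int.induction_on with
      | zero => exact ⟨y, by simp, rfl⟩
      | succ m ihm =>
        obtain ⟨w, hw, hwd⟩ := ihm
        refine ⟨_, ?_, (G.degree_shift i w).trans hwd⟩
        simp only [hw]; push_cast; module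
      | pred m ihm =>
        obtain ⟨w, hw, hwd⟩ := ihm
        have hw' : (w : EuclideanSpace ℝ (Fin d)) - EuclideanSpace.single i 1 ∈ G.V := by
          rw [← G.vertex_shift i, sub_add_cancel]; exact w.2
        refine ⟨⟨_, hw'⟩, ?_, ?_⟩
        · simp only [hw]; push_cast; module
        · rw [← hwd, ← G.degree_shift i ⟨_, hw'⟩]
          congr 1
          exact Subtype.ext (sub_add_cancel _ _)
    obtain ⟨w, hw, hwd⟩ := key (z i)
    refine ⟨w, ?_, hwd.trans hd⟩
    rw [hw, hy, Finset.sum_insert hi]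
    abel

/-- By periodicity the degrees are bounded. -/
theorem bddAbove_range_degree : BddAbove (Set.range G.degree) := by
  have hfin : (G.V ∩ Metric.closedBall 0 (Real.sqrt d)).Finite :=
    G.locally_finite _ Metric.isBounded_closedBall
  have hfin' : {v : G.V | (v : EuclideanSpace ℝ (Fin d)) ∈
      Metric.closedBall (0 : EuclideanSpace ℝ (Fin d)) (Real.sqrt d)}.Finite := by
    refine Set.Finite.of_finite_image (f := Subtype.val) (hfin.subset ?_)
      Subtype.val_injective.injOn
    rintro _ ⟨v, hv, rfl⟩
    exact ⟨v.2, hv⟩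
  refine (hfin'.image G.degree).bddAbove.mono ?_
  rintro _ ⟨x, rfl⟩
  obtain ⟨y, hy, hd⟩ := G.exists_shift (fun i => -⌊(x : EuclideanSpace ℝ (Fin d)) i⌋)
    Finset.univ x
  refine ⟨y, ?_, hd⟩
  have hcoord : ∀ i, (y : EuclideanSpace ℝ (Fin d)) i
      = Int.fract ((x : EuclideanSpace ℝ (Fin d)) i) := by
    intro i
    rw [hy]
    simp [Int.fract, sub_eq_add_neg, Pi.single_apply]
  rw [Set.mem_ofPred_eq, mem_closedBall_zero_iff, EuclideanSpace.norm_eq]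
  apply Real.sqrt_le_sqrt
  calc ∑ i, ‖(y : EuclideanSpace ℝ (Fin d)) i‖ ^ 2 ≤ ∑ _i : Fin d, (1 : ℝ) := by
        refine Finset.sum_le_sum fun i _ => ?_
        rw [hcoord, Real.norm_eq_abs, abs_of_nonneg (Int.fract_nonneg _)]
        exact pow_le_one₀ (Int.fract_nonneg _) (Int.fract_lt_one _).le
    _ = d := by simp

end DGraph

/-!
# Slowly cooled spin-flip dynamics on a `d`-graph flip every site infinitely often

Two facts are to be shown, for almost every sample point of the graphical representation.

*A trajectory exists.* Every vertex lies in finitely many sets of `𝒜_k` (`finite_flipSets_through`),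
and almost surely arrivals do not accumulate (law of large numbers, `ae_tendsto_sum_waiting`) and
never coincide (`ae_sum_waiting_ne`). A trajectory is determined by recording, for each arrival,
whether a flip occurs; the spin at `v` at time `t` is then the initial one times the parity of the
number of accepted arrivals through `v` before `t`. The rule of the dynamics says that the decision
at an arrival is a given function of finitely many earlier decisions. On an infinite graph there is
no first arrival to start a recursion from, but finitely many of these equations can always be
solved, in chronological order, and each of them defines a closed set of decisions; so all of them
have a common solution by compactness (`exists_consistent_decisions`, `exists_isTrajectory`).

*Every site flips infinitely often.* It is enough to consider flips at singletons `{x}`. The energy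
increment at `{x}` is at most `2 d_G` whatever the configuration (`deltaH_singleton_le`), and
`T(t) ln t > 4 d_G` for large `t`, so the flip rate at `{x}` is at least `1 / (1 + t)`
(`heatBath_ge`). The `n`-th arrival occurs before time `2 a (n + 1)` for large `n`, where `a` is the
mean waiting time; so there is a flip whenever the mark is less than `1 / (1 + 2 a (n + 1))`. These
bounds are deterministic and have a divergent sum, and the marks are independent: by the second
Borel–Cantelli lemma this happens infinitely often (`ae_frequently_mark_lt`). As the bound on the
rate is uniform in the configuration, it applies along every trajectory.
-/

/-! ### Self-consistent families of decisions -/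

/-- A self-consistent family of decisions exists as soon as each decision is a function of finitely
many decisions taken at strictly earlier times. The events need not be well ordered in time: any
finite set of the equations is solved in chronological order, and compactness of `E → Bool` does
the rest. -/
theorem exists_consistent_decisions {E : Type*} (τ : E → ℝ≥0) (Φ : E → (E → Bool) → Bool)
    (hΦ : ∀ e, ∃ D : Set E, D.Finite ∧ (∀ e' ∈ D, τ e' < τ e) ∧
      ∀ s s' : E → Bool, (∀ e' ∈ D, s e' = s' e') → Φ e s = Φ e s') :
    ∃ s : E → Bool, ∀ e, s e = Φ e s := by
  classical
  choose D hD hlt hdep using hΦ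
  have hcont : ∀ e, Continuous (Φ e) := by
    intro e
    refine IsLocallyConstant.continuous ((IsLocallyConstant.iff_eventually_eq _).2 fun s => ?_)
    have : ∀ᶠ s' in 𝓝 s, ∀ e' ∈ D e, s' e' = s e' := by
      rw [(hD e).eventually_all]
      intro e' _
      exact (continuous_apply e').continuousAt.eventually
        ((isOpen_discrete {s e'}).mem_nhds rfl)
    filter_upwards [this] with s' hs'
    exact hdep e _ _ hs'
  have hclosed : ∀ e, IsClosed {s : E → Bool | s e = Φ e s} := fun e =>
    isClosed_eq (continuous_apply e) (hcont e)
  have hfin : ∀ F : Finset E, ∃ s : E → Bool, ∀ e ∈ F, s e = Φ e s := by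
    intro F
    induction F using Finset.induction_on_max_value τ with
    | empty => exact ⟨fun _ => false, by simp⟩
    | insert a F ha hmax ih =>
      obtain ⟨s, hs⟩ := ih
      refine ⟨Function.update s a (Φ a s), ?_⟩
      -- changing the decision at the latest event affects none of the other equations
      have hsame : ∀ e, τ e ≤ τ a → Φ e (Function.update s a (Φ a s)) = Φ e s := by
        intro e he
        refine hdep e _ _ fun e' he' => Function.update_of_ne ?_ _ _
        rintro rfl
        exact absurd he (not_le.2 (hlt e _ he'))
      intro e he
      rcases Finset.mem_insert.1 he with rfl | he
      · rw [hsame _ le_rfl, Function.update_self]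
      · rw [hsame _ (hmax e he), Function.update_of_ne (ne_of_mem_of_not_mem he ha), hs e he]
  obtain ⟨s, -, hs⟩ := isCompact_univ.inter_iInter_nonempty _ hclosed fun F => by
    obtain ⟨s, hs⟩ := hfin F
    exact ⟨s, trivial, by simpa using hs⟩
  exact ⟨s, by simpa using hs⟩

namespace DGraph

variable {d : ℕ} (G : DGraph d) {k : ℕ}

/-! ### Local finiteness of the graph and of the energy increment -/

theorem countable_vertices : Countable G.V := by
  have h : G.V = ⋃ n : ℕ, G.V ∩ Metric.closedBall 0 n := by
    rw [← Set.inter_iUnion, Metric.iUnion_closedBall_nat, Set.inter_univ]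
  have : G.V.Countable := by
    rw [h]
    exact Set.countable_iUnion fun n =>
      (G.locally_finite _ Metric.isBounded_closedBall).countable
  exact this.to_subtype

instance countable_flipSet : Countable (G.FlipSet k) := by
  have := G.countable_vertices
  exact inferInstanceAs (Countable {A : Finset G.V // _})

theorem finite_walk_ball (v : G.V) (n : ℕ) :
    {u : G.V | ∃ p : G.graph.Walk u v, p.length ≤ n}.Finite := by
  induction n with
  | zero =>
    refine (Set.finite_singleton v).subset ?_
    rintro u ⟨p, hp⟩
    exact SimpleGraph.Walk.eq_of_length_eq_zero (Nat.le_zero.1 hp)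
  | succ n ih =>
    refine (ih.union (ih.biUnion fun w _ => G.degree_finite w)).subset ?_
    rintro u ⟨p, hp⟩
    cases p with
    | nil => exact Or.inl ⟨.nil, by simp⟩
    | cons h q =>
      refine Or.inr (Set.mem_biUnion (x := _) ⟨q, ?_⟩ h.symm)
      simpa using hp

theorem finite_flipSets_through (v : G.V) : {A : G.FlipSet k | v ∈ A.1}.Finite := by
  classical
  refine Set.Finite.of_finite_image (f := Subtype.val) ?_ Subtype.val_injective.injOn
  refine ((G.finite_walk_ball v k).toFinset.powerset.finite_toSet).subset ?_
  rintro _ ⟨⟨A, hconn, hcard⟩, hA, rfl⟩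
  rw [Finset.mem_coe, Finset.mem_powerset]
  intro u hu
  rw [Set.Finite.mem_toFinset]
  obtain ⟨p, hp⟩ := (hconn.preconnected ⟨u, hu⟩ ⟨v, hA⟩).exists_isPath
  have hlen : (p.map (SimpleGraph.Embedding.induce (A : Set G.V)).toHom).length ≤ k := by
    have := hp.length_lt
    rw [SimpleGraph.Walk.length_map]
    refine this.le.trans (le_trans (le_of_eq ?_) hcard)
    simp
  exact ⟨_, hlen⟩

/-- The endpoints of the boundary edges of `A`: the vertices on which `deltaH J A` depends. -/
def rateSupport (A : Finset G.V) : Set G.V := {v | ∃ e ∈ G.edgeBoundary A, v ∈ (e : Sym2 G.V)}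

theorem rateSupport_finite (A : Finset G.V) : (G.rateSupport A).Finite := by
  have : G.rateSupport A = ⋃ e ∈ G.edgeBoundary A, {v | v ∈ (e : Sym2 G.V)} := by
    ext v; simp [rateSupport]
  rw [this]
  refine (G.edgeBoundary_finite A).biUnion fun e _ => ?_
  induction (e : Sym2 G.V) using Sym2.ind with
  | _ x y =>
    refine (Set.toFinite {x, y}).subset ?_
    intro v hv
    simpa using hv

theorem deltaH_congr (J : G.Interaction) (A : Finset G.V) {σ σ' : G.Config}
    (h : ∀ v ∈ G.rateSupport A, σ v = σ' v) : G.deltaH J A σ = G.deltaH J A σ' := by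
  unfold deltaH
  congr 1
  refine finsum_mem_congr rfl fun e he => ?_
  rw [Sym2.map_congr fun v hv => h v ⟨e, he, hv⟩]

/-! ### Construction of a trajectory -/

/-- The arrivals before time `t`, accepted by the decisions `s`, at sets containing `v`. -/
def accepted (ω : G.Sample k) (s : G.FlipSet k × ℕ → Bool) (t : ℝ≥0) (v : G.V) :
    Set (G.FlipSet k × ℕ) :=
  {e | v ∈ e.1.1 ∧ G.arrival ω e.1 e.2 < t ∧ s e = true}

/-- The configuration at time `t` when the arrivals accepted by the decisions `s` are exactly those
at which a flip occurs. -/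
noncomputable def decided (ω : G.Sample k) (σ₀ : G.Config) (s : G.FlipSet k × ℕ → Bool)
    (t : ℝ≥0) : G.Config :=
  fun v => σ₀ v * (-1) ^ (G.accepted ω s t v).ncard

/-- If arrivals do not accumulate and no two coincide, the graphical representation drives a
trajectory. -/
theorem exists_isTrajectory (J : G.Interaction) (σ₀ : G.Config) (T : ℝ≥0 → ℝ≥0)
    (ω : G.Sample k)
    (hinj : Function.Injective fun e : G.FlipSet k × ℕ => G.arrival ω e.1 e.2)
    (hlf : ∀ A, Tendsto (G.arrival ω A) atTop atTop) :
    ∃ σ, G.IsTrajectory J σ₀ T ω σ := by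
  classical
  have hfin : ∀ (v : G.V) (t : ℝ≥0),
      {e : G.FlipSet k × ℕ | v ∈ e.1.1 ∧ G.arrival ω e.1 e.2 < t}.Finite := by
    intro v t
    have hn : ∀ A, {n | G.arrival ω A n < t}.Finite := by
      intro A
      have := (hlf A).eventually_ge_atTop t
      rw [← Nat.cofinite_eq_atTop, eventually_cofinite] at this
      simpa using this
    refine ((G.finite_flipSets_through v).biUnion fun A _ => (hn A).image (Prod.mk A)).subset ?_
    rintro ⟨A, n⟩ ⟨hv, ht⟩
    exact Set.mem_biUnion (x := A) hv ⟨n, ht, rfl⟩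
  obtain ⟨s, hs⟩ := exists_consistent_decisions
    (fun e : G.FlipSet k × ℕ => G.arrival ω e.1 e.2)
    (fun e s => decide (((ω e).2 : ℝ) < G.rate J T e.1.1 (G.arrival ω e.1 e.2)
      (G.decided ω σ₀ s (G.arrival ω e.1 e.2)))) (by
    intro e
    refine ⟨⋃ v ∈ G.rateSupport e.1.1,
      {e' | v ∈ e'.1.1 ∧ G.arrival ω e'.1 e'.2 < G.arrival ω e.1 e.2},
      (G.rateSupport_finite _).biUnion fun v _ => hfin v _, ?_, ?_⟩
    · intro e' he'
      simp only [Set.mem_iUnion] at he'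
      obtain ⟨v, -, -, h⟩ := he'
      exact h
    · intro s s' hss
      have : G.rate J T e.1.1 (G.arrival ω e.1 e.2) (G.decided ω σ₀ s (G.arrival ω e.1 e.2))
          = G.rate J T e.1.1 (G.arrival ω e.1 e.2)
            (G.decided ω σ₀ s' (G.arrival ω e.1 e.2)) := by
        unfold rate
        rw [G.deltaH_congr]
        intro v hv
        have : G.accepted ω s (G.arrival ω e.1 e.2) v
            = G.accepted ω s' (G.arrival ω e.1 e.2) v := by
          ext e'
          refine and_congr_right fun h1 => and_congr_right fun h2 => ?_
          rw [hss e' (Set.mem_biUnion hv ⟨h1, h2⟩)]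
        simp only [decided, this]
      simp only [this])
  -- right limits count the arrivals up to and including time `t`
  have hright : ∀ (t : ℝ≥0) (v : G.V), ∀ᶠ r in 𝓝[>] t, G.accepted ω s r v =
      {e | v ∈ e.1.1 ∧ G.arrival ω e.1 e.2 ≤ t ∧ s e = true} := by
    intro t v
    have h1 : ∀ᶠ r in 𝓝[>] t, ∀ e ∈ {e : G.FlipSet k × ℕ |
        v ∈ e.1.1 ∧ G.arrival ω e.1 e.2 < t + 1},
        t < G.arrival ω e.1 e.2 → r < G.arrival ω e.1 e.2 := by
      rw [(hfin v _).eventually_all]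
      intro e _
      by_cases h : t < G.arrival ω e.1 e.2
      · filter_upwards [mem_nhdsWithin_of_mem_nhds (Iio_mem_nhds h)] with r hr _ using hr
      · exact Eventually.of_forall fun r h' => absurd h' h
    have h2 : ∀ᶠ r in 𝓝[>] t, r < t + 1 :=
      mem_nhdsWithin_of_mem_nhds (Iio_mem_nhds (lt_add_one t))
    filter_upwards [h1, h2, self_mem_nhdsWithin] with r hr1 hr2 hr3
    ext e
    refine and_congr_right fun hv => and_congr_left fun _ => ⟨fun h => ?_, fun h => ?_⟩
    · by_contra hc
      exact absurd h (hr1 e ⟨hv, h.trans hr2⟩ (not_le.1 hc)).not_gt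
    · exact h.trans_lt hr3
  have hrt : ∀ (t : ℝ≥0) (v : G.V) (a : ℤˣ),
      σ₀ v * (-1) ^ ({e : G.FlipSet k × ℕ |
        v ∈ e.1.1 ∧ G.arrival ω e.1 e.2 ≤ t ∧ s e = true}).ncard = a →
      Tendsto (fun r => G.decided ω σ₀ s r v) (𝓝[>] t) (𝓝 a) := by
    intro t v a ha
    refine tendsto_const_nhds.congr' ?_
    filter_upwards [hright t v] with r hr
    rw [decided, hr, ha]
  -- an arrival that is not accepted, or does not involve `v`, leaves the spin at `v` unchanged
  have hstay : ∀ (t : ℝ≥0) (v : G.V),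
      (∀ e : G.FlipSet k × ℕ, v ∈ e.1.1 → G.arrival ω e.1 e.2 = t → s e = false) →
      Tendsto (fun r => G.decided ω σ₀ s r v) (𝓝[>] t) (𝓝 (G.decided ω σ₀ s t v)) := by
    intro t v h
    refine hrt t v _ ?_
    have : {e : G.FlipSet k × ℕ | v ∈ e.1.1 ∧ G.arrival ω e.1 e.2 ≤ t ∧ s e = true}
        = G.accepted ω s t v := by
      ext e
      refine and_congr_right fun hv => ⟨fun ⟨h1, h2⟩ => ⟨lt_of_le_of_ne h1 fun h3 => ?_, h2⟩,
        fun ⟨h1, h2⟩ => ⟨h1.le, h2⟩⟩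
      rw [h e hv h3] at h2
      exact absurd h2 (by simp)
    rw [this, decided]
  refine ⟨G.decided ω σ₀ s, ?_, ?_, ?_, ?_, ?_⟩
  · funext v
    have : G.accepted ω s 0 v = ∅ := by
      ext e
      simp [accepted]
    simp [decided, this]
  · intro t
    rw [tendsto_pi_nhds]
    intro v
    have h1 : ∀ᶠ r in 𝓝[<] t, ∀ e ∈ {e : G.FlipSet k × ℕ |
        v ∈ e.1.1 ∧ G.arrival ω e.1 e.2 < t}, G.arrival ω e.1 e.2 < r := by
      rw [(hfin v _).eventually_all]
      intro e he
      exact mem_nhdsWithin_of_mem_nhds (Ioi_mem_nhds he.2)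
    refine tendsto_const_nhds.congr' ?_
    filter_upwards [h1, self_mem_nhdsWithin] with r hr1 hr2
    have : G.accepted ω s r v = G.accepted ω s t v := by
      ext e
      exact and_congr_right fun hv => and_congr_left fun _ =>
        ⟨fun h => h.trans hr2, fun h => hr1 e ⟨hv, h⟩⟩
    simp only [decided, this]
  · intro t v h
    exact hstay t v fun e hv ht => absurd ⟨e.2, ht⟩ (h e.1 hv)
  · intro A n hU
    have hsA : s (A, n) = true := by rw [hs]; simpa using hU
    rw [tendsto_pi_nhds]
    intro v
    by_cases hv : v ∈ A.1
    · refine hrt _ v _ ?_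
      have : {e : G.FlipSet k × ℕ |
          v ∈ e.1.1 ∧ G.arrival ω e.1 e.2 ≤ G.arrival ω A n ∧ s e = true}
          = insert (A, n) (G.accepted ω s (G.arrival ω A n) v) := by
        ext e
        simp only [Set.mem_insert_iff, accepted, Set.mem_ofPred_eq]
        constructor
        · rintro ⟨h1, h2, h3⟩
          rcases h2.lt_or_eq with h2 | h2
          · exact Or.inr ⟨h1, h2, h3⟩
          · exact Or.inl (hinj h2)
        · rintro (rfl | ⟨h1, h2, h3⟩)
          · exact ⟨hv, le_rfl, hsA⟩
          · exact ⟨h1, h2.le, h3⟩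
      rw [this, Set.ncard_insert_of_notMem (fun h => lt_irrefl _ h.2.1)
        ((hfin v (G.arrival ω A n)).subset fun e he => ⟨he.1, he.2.1⟩), pow_succ]
      simp [DGraph.flip, hv, decided]
    · have : G.flip A.1 (G.decided ω σ₀ s (G.arrival ω A n)) v
          = G.decided ω σ₀ s (G.arrival ω A n) v := by simp [DGraph.flip, hv]
      rw [this]
      refine hstay _ v fun e hv' he => ?_
      have h3 : e = (A, n) := hinj he
      subst h3
      exact absurd hv' hv
  · intro A n hU
    rw [tendsto_pi_nhds]
    intro v
    refine hstay _ v fun e hv' he => ?_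
    have h3 : e = (A, n) := hinj he
    subst h3
    rw [hs]
    simpa using hU

end DGraph

/-! ### Exponential waiting times and independence -/

theorem nullSingletonClass_expMeasure (r : ℝ) : NullSingletonClass (expMeasure r) :=
  inferInstanceAs (NullSingletonClass (volume.withDensity _))

theorem expMeasure_ae_pos {r : ℝ} : ∀ᵐ x ∂(expMeasure r), 0 < x := by
  have h0 : expMeasure r (Set.Iio 0) = 0 := by
    rw [expMeasure, gammaMeasure, withDensity_apply _ measurableSet_Iio]
    exact lintegral_exponentialPDF_of_nonpos le_rfl
  have := nullSingletonClass_expMeasure r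
  rw [ae_iff]
  have : {a : ℝ | ¬ 0 < a} = Set.Iio 0 ∪ {0} := by
    ext a; simp [le_iff_lt_or_eq]
  rw [this]
  exact measure_union_null h0 (measure_singleton 0)

theorem integrable_id_expMeasure_one : Integrable (fun x : ℝ => x) (expMeasure 1) := by
  have hg : gammaPDF 1 1 = fun x => ENNReal.ofReal (gammaPDFReal 1 1 x) := rfl
  rw [expMeasure, gammaMeasure, hg,
    integrable_withDensity_iff_integrable_smul' (by fun_prop) (by simp)]
  -- the density against `volume` is the integrand of `Γ(2)`
  have h := (integrable_indicator_iff measurableSet_Ioi).2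
    (Real.GammaIntegral_convergent (s := 2) (by norm_num))
  refine h.congr (Eventually.of_forall fun x => ?_)
  by_cases hx : 0 < x
  · simp [gammaPDFReal, hx, hx.le, Real.exp_nonneg]
    norm_num
  · by_cases hx0 : x = 0
    · simp [hx0]
    · have : ¬ 0 ≤ x := fun h => hx (lt_of_le_of_ne h (Ne.symm hx0))
      simp [gammaPDFReal, hx, this]

/-- A random variable without atoms almost surely differs from any independent one. -/
theorem ProbabilityTheory.IndepFun.ae_add_ne_zero {Ω : Type*} [MeasurableSpace Ω] {μ : Measure Ω}
    [IsProbabilityMeasure μ] {X Y : Ω → ℝ} (h : IndepFun X Y μ) (hX : Measurable X)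
    (hY : Measurable Y) [NullSingletonClass (μ.map Y)] : ∀ᵐ ω ∂μ, X ω + Y ω ≠ 0 := by
  have hS : MeasurableSet {p : ℝ × ℝ | p.1 + p.2 = 0} :=
    measurableSet_eq_fun (by fun_prop) (by fun_prop)
  have h1 : μ.map (fun ω => (X ω, Y ω)) {p : ℝ × ℝ | p.1 + p.2 = 0} = 0 := by
    have := Measure.isProbabilityMeasure_map (μ := μ) hY.aemeasurable
    rw [h.map_prod_eq_prod_map_map hX.aemeasurable hY.aemeasurable, Measure.measure_prod_null hS]
    refine Eventually.of_forall fun x => ?_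
    have : Prod.mk x ⁻¹' {p : ℝ × ℝ | p.1 + p.2 = 0} = {-x} := by
      ext y
      simp only [Set.mem_preimage, Set.mem_ofPred_eq, Set.mem_singleton_iff]
      constructor <;> intro h <;> linarith
    simp only [this, Pi.zero_apply, measure_singleton]
  rw [Measure.map_apply (by fun_prop) hS] at h1
  rw [ae_iff]
  simpa using h1

namespace DGraph

variable {d : ℕ} (G : DGraph d) {k : ℕ}

/-! ### Almost sure properties of the graphical representation -/

instance : IsProbabilityMeasure (G.harrisMeasure k) := by
  unfold harrisMeasure; infer_instance

theorem measurable_waiting (e : G.FlipSet k × ℕ) :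
    Measurable fun ω : G.Sample k => (ω e).1 := by fun_prop

theorem harrisMeasure_map_eval (e : G.FlipSet k × ℕ) :
    (G.harrisMeasure k).map (fun ω => ω e) =
      (expMeasure 1).prod (volume : Measure unitInterval) :=
  Measure.infinitePi_map_eval _ e

theorem harrisMeasure_map_waiting (e : G.FlipSet k × ℕ) :
    (G.harrisMeasure k).map (fun ω => (ω e).1) = expMeasure 1 := by
  have : (fun ω : G.Sample k => (ω e).1) = Prod.fst ∘ fun ω => ω e := rfl
  rw [this, ← Measure.map_map measurable_fst (measurable_pi_apply e), harrisMeasure_map_eval,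
    Measure.map_fst_prod]
  simp

theorem harrisMeasure_map_mark (e : G.FlipSet k × ℕ) :
    (G.harrisMeasure k).map (fun ω => (ω e).2) = (volume : Measure unitInterval) := by
  have : (fun ω : G.Sample k => (ω e).2) = Prod.snd ∘ fun ω => ω e := rfl
  rw [this, ← Measure.map_map measurable_snd (measurable_pi_apply e), harrisMeasure_map_eval,
    Measure.map_snd_prod]
  simp

theorem ae_waiting_pos : ∀ᵐ ω ∂(G.harrisMeasure k), ∀ e, 0 < (ω e).1 := by
  rw [ae_all_iff]
  intro e
  have h := expMeasure_ae_pos (r := 1)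
  rw [← G.harrisMeasure_map_waiting e] at h
  exact ae_of_ae_map (G.measurable_waiting e).aemeasurable h

theorem integral_id_expMeasure_one_pos : 0 < ∫ x : ℝ, x ∂(expMeasure 1) := by
  rw [integral_pos_iff_support_of_nonneg_ae (expMeasure_ae_pos.mono fun x hx => hx.le)
    integrable_id_expMeasure_one]
  have : (expMeasure 1) (Function.support fun x : ℝ => x) = 1 :=
    (mem_ae_iff_prob_eq_one (measurableSet_support measurable_id)).1
      (expMeasure_ae_pos.mono fun x hx => hx.ne')
  rw [this]; exact one_pos

/-- The law of large numbers for the arrival times. -/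
theorem ae_tendsto_sum_waiting :
    ∀ᵐ ω ∂(G.harrisMeasure k), ∀ A : G.FlipSet k,
      Tendsto (fun n : ℕ => (∑ i ∈ Finset.range n, (ω (A, i)).1) / (n : ℝ)) atTop
        (𝓝 (∫ x : ℝ, x ∂(expMeasure 1))) := by
  rw [ae_all_iff]
  intro A
  have hind : iIndepFun (fun (e : G.FlipSet k × ℕ) (ω : G.Sample k) => (ω e).1)
      (G.harrisMeasure k) := iIndepFun_infinitePi (fun _ => measurable_fst)
  have hmean : ∫ ω, (ω (A, 0)).1 ∂(G.harrisMeasure k) = ∫ x : ℝ, x ∂(expMeasure 1) := by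
    rw [← G.harrisMeasure_map_waiting (A, 0),
      integral_map (G.measurable_waiting _).aemeasurable (by fun_prop)]
  rw [← hmean]
  refine strong_law_ae_real (fun n (ω : G.Sample k) => (ω (A, n)).1) ?_ ?_ ?_
  · have h := integrable_id_expMeasure_one
    rw [← G.harrisMeasure_map_waiting (A, 0)] at h
    exact (integrable_map_measure (by fun_prop) (G.measurable_waiting _).aemeasurable).1 h
  · intro i j hij
    exact hind.indepFun (by simpa using hij)
  · intro i
    exact ⟨(G.measurable_waiting _).aemeasurable, (G.measurable_waiting _).aemeasurable, by
       rw [harrisMeasure_map_waiting, harrisMeasure_map_waiting]⟩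

/-- Almost surely no two different Poisson processes have a common arrival. -/
theorem ae_sum_waiting_ne : ∀ᵐ ω ∂(G.harrisMeasure k), ∀ A B : G.FlipSet k, A ≠ B →
    ∀ n m : ℕ, ∑ i ∈ Finset.range (n + 1), (ω (A, i)).1 ≠
      ∑ i ∈ Finset.range (m + 1), (ω (B, i)).1 := by
  classical
  simp only [ae_all_iff, eventually_imp_distrib_left]
  intro A B hAB n m
  -- the waiting times at `B` are counted negatively
  have hind : iIndepFun (fun (e : G.FlipSet k × ℕ) (ω : G.Sample k) =>
      (if e.1 = B then -1 else 1) * (ω e).1) (G.harrisMeasure k) :=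
    iIndepFun_infinitePi (X := fun (e : G.FlipSet k × ℕ) (p : ℝ × unitInterval) =>
      (if e.1 = B then -1 else 1) * p.1) (fun _ => by fun_prop)
  set f := fun (e : G.FlipSet k × ℕ) (ω : G.Sample k) =>
      (if e.1 = B then (-1 : ℝ) else 1) * (ω e).1 with hf
  let S : Finset (G.FlipSet k × ℕ) := {A} ×ˢ Finset.range n ∪ {B} ×ˢ Finset.range (m + 1)
  have hS : (A, n) ∉ S := by simp [S, hAB.symm]
  have hfn : f (A, n) = fun ω => (ω (A, n)).1 := by simp [hf, hAB]
  have : NullSingletonClass ((G.harrisMeasure k).map (f (A, n))) := by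
    rw [hfn, harrisMeasure_map_waiting]; exact nullSingletonClass_expMeasure 1
  have key := (hind.indepFun_finsetSum_of_notMem (fun e => by fun_prop) hS).ae_add_ne_zero
    (by fun_prop) (by fun_prop)
  filter_upwards [key] with ω hω heq
  apply hω
  have hdisj : Disjoint ({A} ×ˢ Finset.range n) ({B} ×ˢ Finset.range (m + 1)) :=
    Finset.disjoint_product.2 (Or.inl (by simpa using hAB))
  rw [Finset.sum_apply, Finset.sum_union hdisj, Finset.sum_product, Finset.sum_product,
    Finset.sum_singleton, Finset.sum_singleton]
  simp only [hf, hAB, if_false, if_true, one_mul, neg_one_mul, Finset.sum_neg_distrib]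
  rw [Finset.sum_range_succ] at heq
  linarith

/-- The second Borel–Cantelli lemma for the marks: if `∑ p n = ∞`, infinitely many marks at `A`
satisfy `U_{A,n} < p n`. -/
theorem ae_frequently_mark_lt (A : G.FlipSet k) (p : ℕ → unitInterval)
    (hp : ¬ Summable fun n => (p n : ℝ)) :
    ∀ᵐ ω ∂(G.harrisMeasure k), ∃ᶠ n in atTop, (ω (A, n)).2 < p n := by
  have hind : iIndepFun (fun (e : G.FlipSet k × ℕ) (ω : G.Sample k) => (ω e).2)
      (G.harrisMeasure k) := iIndepFun_infinitePi (fun _ => measurable_snd)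
  have hind' := hind.precomp (g := fun n : ℕ => (A, n)) (Prod.mk_right_injective A)
  let s : ℕ → Set (G.Sample k) := fun n => {ω | (ω (A, n)).2 < p n}
  have hs : ∀ n, MeasurableSet (s n) := fun n =>
    measurableSet_lt (by fun_prop) (by fun_prop)
  have hμ : ∀ n, G.harrisMeasure k (s n) = ENNReal.ofReal (p n) := by
    intro n
    have h := G.harrisMeasure_map_mark (A, n)
    rw [← unitInterval.volume_Iio, ← h, Measure.map_apply (by fun_prop) measurableSet_Iio]
    rfl
  have hsi : iIndepSet s (G.harrisMeasure k) := by
    rw [iIndepSet_iff_meas_biInter hs]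
    intro F
    exact hind'.measure_inter_preimage_eq_mul F (sets := fun n => Set.Iio (p n))
      (fun n _ => measurableSet_Iio)
  have h1 := measure_limsup_eq_one hs hsi (by
    simp only [hμ]
    by_contra hne
    apply hp
    have := ENNReal.summable_toReal hne
    refine this.congr fun n => ?_
    exact ENNReal.toReal_ofReal (p n).2.1)
  have h2 : ∀ᵐ ω ∂(G.harrisMeasure k), ω ∈ limsup s atTop := by
    rw [← prob_compl_eq_zero_iff (MeasurableSet.measurableSet_limsup hs)] at h1
    exact h1
  filter_upwards [h2] with ω hω
  exact Filter.mem_limsup_iff_frequently_mem.1 hω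

end DGraph

namespace DGraph

variable {d : ℕ} (G : DGraph d) {k : ℕ}

/-! ### Flip rates at single vertices -/

/-- The one-vertex set `{x}`, as an element of `𝒜_k`. -/
def singletonFlipSet (hk : 1 ≤ k) (x : G.V) : G.FlipSet k :=
  ⟨{x}, by
    refine ⟨?_, by simpa using hk⟩
    rw [Finset.coe_singleton]
    exact SimpleGraph.Connected.of_subsingleton⟩

theorem ncard_edgeBoundary_singleton_le (x : G.V) :
    (G.edgeBoundary {x}).ncard ≤ G.maxDegree := by
  have h1 : (G.edgeBoundary {x}).ncard ≤ G.degree x := by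
    rw [← Set.ncard_image_of_injective _ Subtype.val_injective]
    have hsub : Subtype.val '' G.edgeBoundary {x} ⊆
        (fun y => s(x, y)) '' G.graph.neighborSet x := by
      rintro _ ⟨e, ⟨z, hz, y, hy, hzy⟩, rfl⟩
      obtain rfl : z = x := by simpa using hz.1
      obtain ⟨u, hu, huy⟩ := hy.2
      obtain rfl : u = z := by simpa using hu
      exact ⟨y, huy, hzy.symm⟩
    exact (Set.ncard_le_ncard hsub ((G.degree_finite x).image _)).trans
      (Set.ncard_image_le (G.degree_finite x))
  exact h1.trans (le_csSup G.bddAbove_range_degree ⟨x, rfl⟩)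

theorem deltaH_singleton_le (J : G.Interaction) (x : G.V) (σ : G.Config) :
    G.deltaH J {x} σ ≤ 2 * G.maxDegree := by
  unfold deltaH
  refine mul_le_mul_of_nonneg_left ?_ (by norm_num)
  rw [finsum_mem_eq_finite_toFinset_sum _ (G.edgeBoundary_finite _)]
  have hle : ∀ u : ℤˣ, (u : ℤ) ≤ 1 := fun u => by
    rcases Int.units_eq_one_or u with rfl | rfl <;> simp
  refine (Finset.sum_le_card_nsmul _ _ 1 fun e _ => hle _).trans ?_
  rw [← Set.ncard_eq_toFinset_card _ (G.edgeBoundary_finite _)]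
  simpa using G.ncard_edgeBoundary_singleton_le x

/-- At a time `t > 1` and a temperature `T > c / ln t`, an energy increment of at most `c / 2` is
accepted with a probability of order at least `1 / t`. The case `D = 0`, `c = 0` is included. -/
theorem heatBath_ge {D : ℤ} {T : ℝ≥0} {t c : ℝ} (hD : 2 * (D : ℝ) ≤ c) (hc : 0 ≤ c)
    (ht : 1 < t) (h : c < T * Real.log t) : 1 / (1 + t) ≤ heatBath D T := by
  have hlog := Real.log_pos ht
  have hT : 0 < (T : ℝ) := by
    by_contra hT
    nlinarith
  have hT' : T ≠ 0 := by
    rintro rfl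
    simp at hT
  have hexp : Real.exp (2 * D / T) ≤ t := by
    rw [← Real.le_log_iff_exp_le (by linarith), div_le_iff₀ hT]
    nlinarith
  have hsplit : Real.exp (2 * D / T) = Real.exp (D / T) * Real.exp (D / T) := by
    rw [← Real.exp_add]; congr 1; ring
  rw [heatBath, if_neg hT', neg_div, Real.exp_neg,
    div_le_div_iff₀ (by linarith) (by positivity)]
  have hpos := Real.exp_pos (D / T)
  rw [hsplit] at hexp
  field_simp
  nlinarith

theorem eventually_lt_mul_log {T : ℝ≥0 → ℝ≥0} {m : ℕ}
    (hlim : ((m : ℕ) : EReal) <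
      liminf (fun t : ℝ≥0 => (((T t : ℝ) * Real.log (t : ℝ) : ℝ) : EReal)) atTop) :
    ∀ᶠ t : ℝ≥0 in atTop, (m : ℝ) < T t * Real.log t := by
  filter_upwards [eventually_lt_of_lt_liminf hlim] with t ht
  exact_mod_cast ht

theorem not_summable_one_div_one_add_mul {C : ℝ} (hC : 0 < C) :
    ¬ Summable fun n : ℕ => 1 / (1 + C * ((n : ℝ) + 1)) := by
  intro h
  apply Real.not_summable_one_div_natCast
  rw [← summable_nat_add_iff 1]
  refine Summable.of_nonneg_of_le (fun n => by positivity) (fun n => ?_) (h.mul_left (1 + C))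
  rw [mul_one_div, div_le_div_iff₀ (by positivity) (by positivity)]
  push_cast
  nlinarith [(Nat.cast_nonneg n : (0 : ℝ) ≤ n)]

end DGraph

/-! ### Infinitely many flips at every vertex -/

theorem mainTheorem3 {d : ℕ} (G : DGraph d) (T : ℝ≥0 → ℝ≥0) (hT : Measurable T)
    (hlim : ((4 * G.maxDegree : ℕ) : EReal) <
      liminf (fun t : ℝ≥0 => (((T t : ℝ) * Real.log (t : ℝ) : ℝ) : EReal)) atTop)
    (k : ℕ) (hk : 1 ≤ k) (J : G.Interaction) (σ₀ : G.Config) :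
    G.IsTypeI k J σ₀ T := by
  have := G.countable_vertices
  set a : ℝ := ∫ x : ℝ, x ∂(expMeasure 1)
  have ha : 0 < a := DGraph.integral_id_expMeasure_one_pos
  -- eventually `τ_{A,n} ≤ 2 a (n + 1)`, so marks below `p n` lie below the acceptance rate
  have hp_mem : ∀ n : ℕ, 1 / (1 + 2 * a * ((n : ℝ) + 1)) ∈ unitInterval := fun n =>
    ⟨by positivity, by
      rw [div_le_one (by positivity)]
      exact le_add_of_nonneg_right (by positivity)⟩
  let p : ℕ → unitInterval := fun n => ⟨_, hp_mem n⟩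
  have hp : ¬ Summable fun n => (p n : ℝ) :=
    DGraph.not_summable_one_div_one_add_mul (C := 2 * a) (by positivity)
  have hmark : ∀ᵐ ω ∂(G.harrisMeasure k), ∀ x : G.V,
      ∃ᶠ n in atTop, (ω (G.singletonFlipSet hk x, n)).2 < p n :=
    ae_all_iff.2 fun x => G.ae_frequently_mark_lt _ p hp
  filter_upwards [hmark, G.ae_waiting_pos, G.ae_tendsto_sum_waiting, G.ae_sum_waiting_ne]
    with ω hmark hpos hlln hne
  have harr : ∀ A n, (G.arrival ω A n : ℝ) = ∑ i ∈ Finset.range (n + 1), (ω (A, i)).1 :=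
    fun A n => Real.coe_toNNReal _ (Finset.sum_nonneg fun i _ => (hpos _).le)
  have hmono : ∀ A, StrictMono (G.arrival ω A) := by
    intro A
    refine strictMono_nat_of_lt_succ fun n => ?_
    rw [← NNReal.coe_lt_coe, harr, harr, Finset.sum_range_succ _ (n + 1)]
    exact lt_add_of_pos_right _ (hpos _)
  have hratio : ∀ A, Tendsto (fun n : ℕ => (G.arrival ω A n : ℝ) / ((n : ℝ) + 1)) atTop (𝓝 a) := by
    intro A
    refine ((tendsto_add_atTop_iff_nat 1).2 (hlln A)).congr fun n => ?_
    rw [harr]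
    push_cast
    rfl
  have hlf : ∀ A, Tendsto (G.arrival ω A) atTop atTop := by
    intro A
    rw [← NNReal.tendsto_coe_atTop]
    have h1 : Tendsto (fun n : ℕ => (n : ℝ) + 1) atTop atTop :=
      tendsto_atTop_add_const_right _ _ tendsto_natCast_atTop_atTop
    refine ((hratio A).pos_mul_atTop ha h1).congr fun n => ?_
    field_simp
  refine ⟨G.exists_isTrajectory J σ₀ T ω ?_ hlf, ?_⟩
  · rintro ⟨A, n⟩ ⟨B, m⟩ h
    by_cases hAB : A = B
    · subst hAB
      exact congrArg (Prod.mk A) ((hmono A).injective h)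
    · refine absurd ?_ (hne A B hAB n m)
      rw [← harr, ← harr]
      exact congrArg _ h
  · intro σ hσ x
    set A := G.singletonFlipSet hk x
    have hrate : ∀ᶠ n in atTop, (p n : ℝ) ≤
        G.rate J T A.1 (G.arrival ω A n) (σ (G.arrival ω A n)) := by
      have h1 := (hlf A).eventually
        ((DGraph.eventually_lt_mul_log hlim).and (eventually_gt_atTop 1))
      have h2 := (hratio A).eventually_lt_const (show a < 2 * a by linarith)
      filter_upwards [h1, h2] with n ⟨hn1, hn2⟩ hn3
      rw [div_lt_iff₀ (by positivity)] at hn3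
      have hD : (G.deltaH J A.1 (σ (G.arrival ω A n)) : ℝ) ≤ 2 * G.maxDegree := by
        exact_mod_cast G.deltaH_singleton_le J x (σ (G.arrival ω A n))
      refine le_trans ?_ (DGraph.heatBath_ge (c := ((4 * G.maxDegree : ℕ) : ℝ)) ?_
        (Nat.cast_nonneg _) (by exact_mod_cast hn2) hn1)
      · exact one_div_le_one_div_of_le (by positivity) (by linarith)
      · push_cast; linarith
    have hinf : {n | (ω (A, n)).2 < p n ∧ (p n : ℝ) ≤
        G.rate J T A.1 (G.arrival ω A n) (σ (G.arrival ω A n))}.Infinite :=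
      Nat.frequently_atTop_iff_infinite.1 ((hmark x).and_eventually hrate)
    refine (hinf.image (hmono A).injective.injOn).mono ?_
    rintro _ ⟨n, ⟨hn1, hn2⟩, rfl⟩
    exact ⟨A, Finset.mem_singleton_self x, ⟨n, rfl⟩,
      hσ.flip A n ((Subtype.coe_lt_coe.2 hn1).trans_le hn2)⟩
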